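/- Let $G=(V,E)$ be a finite multigraph (parallel edges are allowed, loops are not). A graph is connected if it has at least one vertex and any two of its vertices are joined by a path. For an integer $l\ge 0$, call $G$ $l$-edge-connected if every set $S\subseteq E$ for which $G-S$ is not connected has at least $l$ edges (so a graph with a single vertex is $l$-edge-connected for every $l$). A spanning tree packing of cardinality $k$ of a graph $H$ consists of $k$ spanning trees $T_1,\dots,T_k$ of $H$ whose edge sets are pairwise disjoint. Then: 1. For every integer $k\ge 0$, $G$ is $2k$-edge-connected if and only if $G-F$ admits a spanning tree packing of cardinality $k$ for every set $F\subseteq E$ of at most $k$ edges. 2. For every integer $k\ge 1$, $G$ is $(2k+1)$-edge-connected if and only if $G-F$ admits a spanning tree packing of cardinality $k$ for every set $F\subseteq E$ of at most $k+1$ edges. -/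

import Mathlib

/-! Multigraphs are Mathlib's `Graph α β`: a set of vertices in `α`, a set of edges in `β`, and an
incidence relation `G.IsLink e x y`; parallel edges are allowed. -/

namespace Graph

variable {α β : Type*}

/-- `G` is connected: it has a vertex, and any two vertices are joined by a walk. -/
def Connected (G : Graph α β) : Prop :=
  G.vertexSet.Nonempty ∧
    ∀ x ∈ G.vertexSet, ∀ y ∈ G.vertexSet, Relation.ReflTransGen G.Adj x y

/-- `G` contains no cycle. A cycle of length `n + 1` is a cyclic sequence of distinct vertices `v i`
and distinct edges `e i` such that `e i` joins `v i` to `v (i + 1)`; the sum in `Fin (n + 1)` wraps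
around. Length `1` is a loop, length `2` is a pair of parallel edges. -/
def Acyclic (G : Graph α β) : Prop :=
  ∀ (n : ℕ) (v : Fin (n + 1) → α) (e : Fin (n + 1) → β),
    Function.Injective v → Function.Injective e → ¬ ∀ i, G.IsLink (e i) (v i) (v (i + 1))

/-- A tree is a connected acyclic graph. -/
def IsTree (G : Graph α β) : Prop := G.Connected ∧ G.Acyclic

/-- `T` is a spanning tree of `G`: a tree that is a subgraph of `G` with the same vertices. -/
def IsSpanningTree (T G : Graph α β) : Prop := T.IsSpanningSubgraph G ∧ T.IsTree

/-- `G` admits a spanning tree packing of cardinality `k`: there are `k` spanning trees of `G` with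
pairwise disjoint edge sets. -/
def HasSpanningTreePacking (G : Graph α β) (k : ℕ) : Prop :=
  ∃ T : Fin k → Graph α β, (∀ i, (T i).IsSpanningTree G) ∧
    ∀ i j, i ≠ j → Disjoint (T i).edgeSet (T j).edgeSet

/-- `S` is an edge cut of `G`: a set of edges for which `G - S` is not connected. -/
def IsEdgeCut (G : Graph α β) (S : Set β) : Prop :=
  S ⊆ G.edgeSet ∧ ¬ (G.deleteEdges S).Connected

/-- The edge connectivity of `G`: the least number of edges in an edge cut (`⊤` if there is none,
that is, for a graph with just one vertex). -/
noncomputable def edgeConnectivity (G : Graph α β) : ℕ∞ :=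
  ⨅ S ∈ {S : Set β | G.IsEdgeCut S}, S.encard

/-- `G` is `l`-edge-connected: no set of fewer than `l` edges disconnects `G`. -/
def IsEdgeConnected (G : Graph α β) (l : ℕ) : Prop := (l : ℕ∞) ≤ G.edgeConnectivity

end Graph

/-!
Both parts are instances of one statement, `Graph.isEdgeConnected_add_iff`: for `1 ≤ k ≤ m`, the
graph `G` is `(k + m)`-edge-connected if and only if `G - F` packs `k` spanning trees whenever
`|F| ≤ m`. The parts are the cases `m = k` and `m = k + 1`.

If all these packings exist and `S` is an edge cut with `|S| ≥ m`, choose `F ⊆ S` with `|F| = m`.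
Every spanning tree of `G - F` uses an edge of `S \ F`, so `|S \ F| ≥ k` and `|S| ≥ k + m`. A cut
with fewer than `m` edges is impossible, as deleting it would leave a connected graph.

For the converse, the Nash-Williams–Tutte theorem is obtained from the base packing theorem of
Edmonds, `exists_disjoint_bases`, for the vectors `x + y` over `ZMod 2` attached to the edges `xy`.
Independent sets of such vectors are acyclic, and spanning sets are connected.

The base packing theorem is proved by exchanges. Take disjoint independent sets `I i` covering as
many elements as possible, and let `A` be the set of all elements that are left uncovered by some
packing reachable from `I` by exchanging single elements. If a reachable packing `J` leaves `e`
uncovered, then the fundamental circuit of `e` with respect to each `J i` lies in `A`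
(`mem_span_inter_reachableUncovered`). Hence exchanges do not enlarge the span of `J i ∩ A`
(`span_inter_reachableUncovered_le`), so each `I i ∩ A` spans `A`, while everything outside `A` is
covered by `I`. Counting gives `∑ |I i| ≥ |E \ A| + k * r(A)`, which the rank condition bounds below
by `k * r(E)`; thus each `I i` is a basis.

The rank condition for `G - F` follows by double counting
(`Graph.IsEdgeConnected.card_components_mul_le`): if `(V, A)` has `c ≥ 2` components, each has at
least `k + m` boundary edges in `G`, and each edge outside `A` is in at most two boundaries.
-/

open Finset Submodule

/-! ### Packing bases in a finite family of vectors -/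

section Packing

variable {K M β ι : Type*} [Field K] [AddCommGroup M] [Module K M]

/-- A family of pairwise disjoint subsets of `E`, indexed by `ι`, on each of which the vectors `v`
are linearly independent. -/
structure IsIndepPacking (K : Type*) {M β ι : Type*} [Field K] [AddCommGroup M] [Module K M]
    (v : β → M) (E : Finset β) (I : ι → Finset β) : Prop where
  subset : ∀ i, I i ⊆ E
  indep : ∀ i, LinearIndepOn K v (I i : Set β)
  disjoint : ∀ i j, i ≠ j → Disjoint (I i) (I j)

variable {v : β → M} {E : Finset β} {I J : ι → Finset β}

theorem IsIndepPacking.update [DecidableEq ι] (hI : IsIndepPacking K v E I) {i : ι}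
    {S : Finset β} (hSE : S ⊆ E) (hS : LinearIndepOn K v (S : Set β))
    (hd : ∀ j, j ≠ i → Disjoint S (I j)) :
    IsIndepPacking K v E (Function.update I i S) where
  subset j := by
    rcases eq_or_ne j i with rfl | h
    · simpa
    · simpa [h] using hI.subset j
  indep j := by
    rcases eq_or_ne j i with rfl | h
    · simpa
    · simpa [h] using hI.indep j
  disjoint j l hjl := by
    rcases eq_or_ne j i with rfl | h
    · simpa [hjl.symm] using hd l hjl.symm
    · rcases eq_or_ne l i with rfl | h'
      · simpa [h] using (hd j h).symm
      · simpa [h, h'] using hI.disjoint j l hjl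

/-- An independent packing `J` arises from `I` by an exchange: in one member, an element `f` is
replaced by an element `e` which no member of `I` contains. -/
def IsExchange [DecidableEq β] [DecidableEq ι] (K : Type*) [Field K] [Module K M]
    (v : β → M) (E : Finset β) (I J : ι → Finset β) : Prop :=
  IsIndepPacking K v E J ∧ ∃ i, ∃ e ∈ E, ∃ f ∈ I i, (∀ j, e ∉ I j) ∧
    J = Function.update I i (insert e ((I i).erase f))

/-- The number of elements covered is at least that of every other independent packing. -/
def IsMaxPacking [Fintype ι] (K : Type*) [Field K] [Module K M]
    (v : β → M) (E : Finset β) (I : ι → Finset β) : Prop :=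
  IsIndepPacking K v E I ∧ ∀ J : ι → Finset β, IsIndepPacking K v E J →
    ∑ i, #(J i) ≤ ∑ i, #(I i)

theorem finrank_span_image_finset_le (v : β → M) (S : Finset β) :
    Module.finrank K (span K (v '' (S : Set β))) ≤ #S := by
  classical
  rw [← coe_image]
  exact (finrank_span_finset_le_card (S.image v)).trans card_image_le

theorem finrank_span_image_eq_card {S : Finset β} (hS : LinearIndepOn K v (S : Set β)) :
    Module.finrank K (span K (v '' (S : Set β))) = #S := by
  classical
  rw [← card_image_of_injOn hS.injOn, ← finrank_span_finset_eq_card (R := K), coe_image]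
  rw [coe_image]
  exact hS.id_image

theorem finrank_span_image_mono (v : β → M) {S T : Finset β}
    (h : span K (v '' (S : Set β)) ≤ span K (v '' (T : Set β))) :
    Module.finrank K (span K (v '' (S : Set β))) ≤
      Module.finrank K (span K (v '' (T : Set β))) :=
  have := FiniteDimensional.span_of_finite K (T.finite_toSet.image v)
  Submodule.finrank_mono h

variable [DecidableEq β] [DecidableEq ι]

theorem IsExchange.isMaxPacking [Fintype ι] (hI : IsMaxPacking K v E I)
    (h : IsExchange K v E I J) : IsMaxPacking K v E J := by
  obtain ⟨hJ, i, e, -, f, hf, he, rfl⟩ := h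
  refine ⟨hJ, fun L hL ↦ (hI.2 L hL).trans (Finset.sum_le_sum fun j _ ↦ ?_)⟩
  rcases eq_or_ne j i with rfl | hji
  · have : e ∉ (I j).erase f := fun h ↦ he j (mem_of_mem_erase h)
    rw [Function.update_self, card_insert_of_notMem this, card_erase_add_one hf]
  · simp [hji]

theorem isMaxPacking_of_reflTransGen [Fintype ι] (hI : IsMaxPacking K v E I)
    (h : Relation.ReflTransGen (IsExchange K v E) I J) : IsMaxPacking K v E J := by
  induction h with
  | refl => exact hI
  | tail _ h ih => exact h.isMaxPacking ih

/-- Otherwise `e` could be added to the member `I i`. -/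
theorem IsMaxPacking.mem_span [Fintype ι] (hI : IsMaxPacking K v E I) {e : β} (heE : e ∈ E)
    (he : ∀ j, e ∉ I j) (i : ι) : v e ∈ span K (v '' (I i : Set β)) := by
  by_contra hspan
  have hJ : IsIndepPacking K v E (Function.update I i (insert e (I i))) := by
    refine hI.1.update (insert_subset heE (hI.1.subset i)) ?_ fun j hj ↦ ?_
    · rw [coe_insert]
      exact (hI.1.indep i).insert hspan
    · exact disjoint_insert_left.2 ⟨he j, hI.1.disjoint i j hj.symm⟩
  refine (hI.2 _ hJ).not_gt (Finset.sum_lt_sum (fun j _ ↦ ?_) ⟨i, mem_univ i, ?_⟩)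
  · rcases eq_or_ne j i with rfl | hji
    · simpa using card_le_card (subset_insert e (I j))
    · simp [hji]
  · simp [card_insert_of_notMem (he i)]

/-- The elements that are left uncovered by some packing reachable from `I` by exchanges. -/
def reachableUncovered (K : Type*) [Field K] [Module K M]
    (v : β → M) (E : Finset β) (I : ι → Finset β) : Set β :=
  {e | e ∈ E ∧ ∃ J, Relation.ReflTransGen (IsExchange K v E) I J ∧ ∀ j, e ∉ J j}

/-- Every element of the fundamental circuit of `e` with respect to `J i` can be exchanged for `e`,
so the circuit lies in the set of reachable uncovered elements. -/
theorem mem_span_inter_reachableUncovered [Fintype ι] (hI : IsMaxPacking K v E I)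
    (hIJ : Relation.ReflTransGen (IsExchange K v E) I J) {e : β} (heE : e ∈ E)
    (he : ∀ j, e ∉ J j) (i : ι) :
    v e ∈ span K (v '' ((J i : Set β) ∩ reachableUncovered K v E I)) := by
  have hJ := isMaxPacking_of_reflTransGen hI hIJ
  obtain ⟨c, hc⟩ := Submodule.mem_span_image_finset_iff_exists_fun' K |>.1 (hJ.mem_span heE he i)
  rw [← hc]
  refine sum_mem fun f hf ↦ ?_
  rcases eq_or_ne (c f) 0 with h0 | h0
  · simp [h0]
  refine smul_mem _ _ (subset_span ⟨f, ⟨hf, hJ.1.subset i hf, ?_⟩, rfl⟩)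
  -- `e` is independent of the remaining vectors since `v f` occurs in its expansion
  have hspan : v e ∉ span K (v '' ((J i).erase f : Finset β)) := by
    intro hmem
    have hfe : v f ∈ span K (v '' ((J i).erase f : Finset β)) := by
      rw [← add_sum_erase _ _ hf] at hc
      have hcf : c f • v f ∈ span K (v '' ((J i).erase f : Finset β)) := by
        rw [eq_sub_of_add_eq hc]
        exact sub_mem hmem (sum_mem fun g hg ↦ smul_mem _ _ (subset_span ⟨g, hg, rfl⟩))
      simpa [h0] using smul_mem _ (c f)⁻¹ hcf
    have hind := hJ.1.indep i
    rw [← insert_erase hf, coe_insert, linearIndepOn_insert (by simp)] at hind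
    exact hind.2 hfe
  refine ⟨_, hIJ.tail ⟨?_, i, e, heE, f, hf, he, rfl⟩, fun j ↦ ?_⟩
  · refine hJ.1.update (insert_subset heE ((erase_subset _ _).trans (hJ.1.subset i))) ?_
      fun j hj ↦ ?_
    · rw [coe_insert]
      exact LinearIndepOn.insert ((hJ.1.indep i).mono (by simp)) hspan
    · exact disjoint_insert_left.2
        ⟨he j, disjoint_of_subset_left (erase_subset _ _) (hJ.1.disjoint i j hj.symm)⟩
  · rcases eq_or_ne j i with rfl | hji
    · have : f ≠ e := fun h ↦ he j (h ▸ hf)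
      simp [this]
    · rw [Function.update_of_ne hji]
      exact disjoint_left.1 (hJ.1.disjoint i j hji.symm) hf

theorem span_inter_reachableUncovered_le [Fintype ι] (hI : IsMaxPacking K v E I)
    (hIJ : Relation.ReflTransGen (IsExchange K v E) I J) (i : ι) :
    span K (v '' ((J i : Set β) ∩ reachableUncovered K v E I)) ≤
      span K (v '' ((I i : Set β) ∩ reachableUncovered K v E I)) := by
  induction hIJ with
  | refl => rfl
  | @tail J L hIJ hJL ih =>
    refine le_trans ?_ ih
    obtain ⟨-, j, e, heE, f, -, he, rfl⟩ := hJL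
    rw [span_le]
    rintro _ ⟨g, ⟨hg, hgA⟩, rfl⟩
    rcases eq_or_ne i j with rfl | hij
    · rw [Function.update_self, coe_insert] at hg
      obtain rfl | hg := hg
      · exact mem_span_inter_reachableUncovered hI hIJ heE he i
      · exact subset_span ⟨g, ⟨mem_of_mem_erase hg, hgA⟩, rfl⟩
    · rw [Function.update_of_ne hij] at hg
      exact subset_span ⟨g, ⟨hg, hgA⟩, rfl⟩

/-- The base packing theorem of Edmonds for the matroid of a finite family of vectors: if
`k * (r(E) - r(A)) ≤ |E \ A|` for every `A ⊆ E`, then `E` contains `k` disjoint bases. -/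
theorem exists_disjoint_bases [Fintype ι] (v : β → M) (E : Finset β)
    (h : ∀ A ⊆ E, Fintype.card ι * Module.finrank K (span K (v '' (E : Set β))) ≤
      #(E \ A) + Fintype.card ι * Module.finrank K (span K (v '' (A : Set β)))) :
    ∃ I : ι → Finset β, IsIndepPacking K v E I ∧
      ∀ i, span K (v '' (E : Set β)) ≤ span K (v '' (I i : Set β)) := by
  classical
  obtain ⟨I, hI⟩ : ∃ I : ι → Finset β, IsMaxPacking K v E I := by
    have hfin : {I : ι → Finset β | IsIndepPacking K v E I}.Finite :=
      (Set.Finite.pi' fun _ ↦ E.powerset.finite_toSet).subset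
        fun I hI i ↦ mem_powerset.2 (hI.subset i)
    obtain ⟨I, hI, hmax⟩ := hfin.exists_maximalFor (fun I ↦ ∑ i, #(I i)) _
      ⟨fun _ ↦ ∅, fun i ↦ by simp, fun i ↦ by simp, fun i j _ ↦ by simp⟩
    refine ⟨I, hI, fun J hJ ↦ ?_⟩
    by_contra! hlt
    exact hlt.not_ge (hmax hJ hlt.le)
  refine ⟨I, hI.1, ?_⟩
  set A : Finset β := E.filter (· ∈ reachableUncovered K v E I) with hA
  have hAE : A ⊆ E := filter_subset _ _
  have hIA (i) : ((I i ∩ A : Finset β) : Set β) = (I i : Set β) ∩ reachableUncovered K v E I := by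
    ext e
    simp only [hA, coe_inter, coe_filter, Set.mem_inter_iff, mem_coe, Set.mem_ofPred_eq]
    exact ⟨fun h ↦ ⟨h.1, h.2.2⟩, fun h ↦ ⟨h.1, hI.1.subset i h.1, h.2⟩⟩
  have hrankA (i) : Module.finrank K (span K (v '' (A : Set β))) ≤ #(I i ∩ A) := by
    refine (finrank_span_image_mono v ?_).trans (finrank_span_image_finset_le v _)
    rw [span_le, hIA]
    rintro _ ⟨e, he, rfl⟩
    obtain ⟨heE, J, hIJ, heJ⟩ := (mem_filter.1 he).2
    exact span_inter_reachableUncovered_le hI hIJ i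
      (mem_span_inter_reachableUncovered hI hIJ heE heJ i)
  have hcover : #(E \ A) ≤ ∑ i, #(I i \ A) := by
    refine (card_le_card fun e he ↦ ?_).trans card_biUnion_le
    obtain ⟨heE, heA⟩ := mem_sdiff.1 he
    by_contra hne
    simp only [mem_biUnion, mem_univ, true_and, mem_sdiff, not_exists, not_and, not_not] at hne
    exact heA (mem_filter.2 ⟨heE, heE, I, .refl, fun j hj ↦ heA (hne j hj)⟩)
  have hle (i) : #(I i) ≤ Module.finrank K (span K (v '' (E : Set β))) := by
    rw [← finrank_span_image_eq_card (hI.1.indep i)]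
    exact finrank_span_image_mono v (span_mono (Set.image_mono (hI.1.subset i)))
  have hsum : ∑ _i : ι, Module.finrank K (span K (v '' (E : Set β))) ≤ ∑ i, #(I i) := by
    calc _ = Fintype.card ι * Module.finrank K (span K (v '' (E : Set β))) := by simp
      _ ≤ #(E \ A) + ∑ _i : ι, Module.finrank K (span K (v '' (A : Set β))) := by
        simpa using h A hAE
      _ ≤ ∑ i, #(I i \ A) + ∑ i, #(I i ∩ A) :=
        add_le_add hcover (Finset.sum_le_sum fun i _ ↦ hrankA i)
      _ = ∑ i, #(I i) := by
        rw [← sum_add_distrib]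
        exact sum_congr rfl fun i _ ↦ card_sdiff_add_card_inter _ _
  have heq := (sum_eq_sum_iff_of_le fun i _ ↦ hle i).1
    (le_antisymm (Finset.sum_le_sum fun i _ ↦ hle i) hsum)
  intro i
  have := FiniteDimensional.span_of_finite K (E.finite_toSet.image v)
  refine (Submodule.eq_of_le_of_finrank_eq
    (span_mono (Set.image_mono (hI.1.subset i))) ?_).ge
  rw [finrank_span_image_eq_card (hI.1.indep i), heq i (mem_univ i)]

end Packing

/-! ### Edge vectors over `ZMod 2` -/

namespace Graph

variable {α β : Type*} {G H : Graph α β}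

open Classical in
/-- The vector over `ZMod 2` of an edge `e` with ends `x` and `y`, that is `x + y`; it is `0` if `e`
is not an edge of `G`. -/
noncomputable def edgeVec (G : Graph α β) (e : β) : α →₀ ZMod 2 :=
  if h : ∃ x y, G.IsLink e x y then
    Finsupp.single h.choose 1 + Finsupp.single h.choose_spec.choose 1
  else 0

theorem IsLink.edgeVec_eq {e : β} {x y : α} (h : G.IsLink e x y) :
    G.edgeVec e = Finsupp.single x 1 + Finsupp.single y 1 := by
  have hex : ∃ x y, G.IsLink e x y := ⟨x, y, h⟩
  rw [edgeVec, dif_pos hex]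
  obtain ⟨h1, h2⟩ | ⟨h1, h2⟩ := hex.choose_spec.choose_spec.eq_and_eq_or_eq_and_eq h
  · exact congrArg₂ (fun a b ↦ Finsupp.single a 1 + Finsupp.single b 1) h1 h2
  · exact (congrArg₂ (fun a b ↦ Finsupp.single a 1 + Finsupp.single b 1) h1 h2).trans
      (add_comm _ _)

theorem finsupp_zmod_two_add_self (f : α →₀ ZMod 2) : f + f = 0 := by
  ext x
  exact CharTwo.add_self_eq_zero (f x)

theorem reflTransGen_adj_symm {x y : α} (h : Relation.ReflTransGen G.Adj x y) :
    Relation.ReflTransGen G.Adj y x :=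
  have : Std.Symm G.Adj := ⟨fun _ _ h ↦ (G.adj_comm _ _).1 h⟩
  Relation.ReflTransGen.stdSymm.symm _ _ h

/-- The span of the edge vectors detects connectivity: the sum of the values on the component of `x`
is a linear functional which vanishes on all edge vectors. -/
theorem single_add_single_mem_span_iff {S : Set β} {x y : α} :
    (Finsupp.single x 1 + Finsupp.single y 1 : α →₀ ZMod 2) ∈ span (ZMod 2) (G.edgeVec '' S) ↔
      Relation.ReflTransGen (G.restrict S).Adj x y := by
  classical
  constructor
  · intro h
    let φ : (α →₀ ZMod 2) →ₗ[ZMod 2] ZMod 2 := Finsupp.linearCombination (ZMod 2)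
      fun z ↦ if Relation.ReflTransGen (G.restrict S).Adj x z then 1 else 0
    have hφ : span (ZMod 2) (G.edgeVec '' S) ≤ LinearMap.ker φ := by
      rw [span_le]
      rintro _ ⟨e, he, rfl⟩
      rw [SetLike.mem_coe, LinearMap.mem_ker]
      by_cases hex : ∃ u w, G.IsLink e u w
      · obtain ⟨u, w, huw⟩ := hex
        have hadj : (G.restrict S).Adj u w := ⟨e, he, huw⟩
        have hiff : Relation.ReflTransGen (G.restrict S).Adj x u ↔
            Relation.ReflTransGen (G.restrict S).Adj x w :=
          ⟨fun h ↦ h.tail hadj, fun h ↦ h.tail hadj.symm⟩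
        rw [huw.edgeVec_eq]
        simp only [φ, map_add, Finsupp.linearCombination_single, hiff, one_smul]
        exact CharTwo.add_self_eq_zero _
      · rw [edgeVec, dif_neg hex, map_zero]
    by_contra hxy
    have h0 := LinearMap.mem_ker.1 (hφ h)
    simp [φ, hxy, Relation.ReflTransGen.refl] at h0
  · intro h
    induction h with
    | refl => simp [finsupp_zmod_two_add_self]
    | @tail y z _ hyz ih =>
      obtain ⟨e, he, hlink⟩ := hyz
      have := add_mem ih (subset_span (R := ZMod 2) (Set.mem_image_of_mem G.edgeVec he))
      rw [hlink.edgeVec_eq] at this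
      convert this using 1
      rw [add_add_add_comm, ← add_assoc, add_right_comm (Finsupp.single x 1) _ (Finsupp.single y 1),
        add_assoc (Finsupp.single x 1), finsupp_zmod_two_add_self, add_zero]

/-- The edge vectors of a cycle sum to zero. -/
theorem acyclic_restrict_of_linearIndepOn {S : Set β}
    (hS : LinearIndepOn (ZMod 2) G.edgeVec S) : (G.restrict S).Acyclic := by
  intro n v e _ he h
  have hind : LinearIndependent (ZMod 2) (fun i ↦ G.edgeVec (e i)) :=
    hS.linearIndependent.comp (fun i ↦ (⟨e i, (h i).1⟩ : S))
      fun i j hij ↦ he (Subtype.ext_iff.1 hij)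
  have hsum : ∑ i, (1 : ZMod 2) • G.edgeVec (e i) = 0 := by
    have hshift : ∑ i, (Finsupp.single (v (i + 1)) 1 : α →₀ ZMod 2) =
        ∑ i, Finsupp.single (v i) 1 :=
      Equiv.sum_comp (Equiv.addRight (1 : Fin (n + 1)))
        fun i ↦ (Finsupp.single (v i) 1 : α →₀ ZMod 2)
    simp only [one_smul, (h _).2.edgeVec_eq, sum_add_distrib, hshift, finsupp_zmod_two_add_self]
  exact one_ne_zero (Fintype.linearIndependent_iff.1 hind (fun _ ↦ 1) hsum 0)

theorem connected_restrict_of_span_le (hG : G.Connected) {S : Set β}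
    (hS : span (ZMod 2) (G.edgeVec '' G.edgeSet) ≤ span (ZMod 2) (G.edgeVec '' S)) :
    (G.restrict S).Connected := by
  refine ⟨hG.1, fun x hx y hy ↦ single_add_single_mem_span_iff.1 (hS ?_)⟩
  rw [single_add_single_mem_span_iff, restrict_self]
  exact hG.2 x hx y hy

/-! ### Components and boundaries -/

/-- The vertices reachable from `x`. -/
def componentSet (G : Graph α β) (x : α) : Set α := {y | Relation.ReflTransGen G.Adj x y}

theorem componentSet_eq_iff {x y : α} :
    G.componentSet x = G.componentSet y ↔ Relation.ReflTransGen G.Adj x y := by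
  constructor
  · intro h
    have : y ∈ G.componentSet y := Relation.ReflTransGen.refl
    rwa [← h] at this
  · intro h
    ext z
    exact ⟨fun hz ↦ (reflTransGen_adj_symm h).trans hz, fun hz ↦ h.trans hz⟩

open Classical in
/-- The components of `(V, A)`, as a finite set of vertex sets. -/
noncomputable def components (G : Graph α β) (V : Finset α) (A : Set β) : Finset (Set α) :=
  V.image (G.restrict A).componentSet

/-- In terms of ranks in the cycle matroid, `r(E) ≤ r(A) + (c - 1)` where `c` is the number of
components of `(V, A)`: modulo the span of `A`, every vertex equals a representative of its
component. -/
theorem finrank_span_edgeVec_le {V : Finset α} (hV : (V : Set α) = G.vertexSet)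
    (hne : V.Nonempty) (E A : Finset β) :
    Module.finrank (ZMod 2) (span (ZMod 2) (G.edgeVec '' (E : Set β))) + 1 ≤
      Module.finrank (ZMod 2) (span (ZMod 2) (G.edgeVec '' (A : Set β))) +
        #(G.components V A) := by
  classical
  obtain ⟨x₀, hx₀⟩ := hne
  set comp := (G.restrict (A : Set β)).componentSet
  have hP : ∀ x ∈ V, comp x ∈ G.components V A := fun x hx ↦ mem_image_of_mem _ hx
  have hrep : ∀ C : Set α, ∃ x, C ∈ G.components V A → comp x = C := by
    intro C
    by_cases hC : C ∈ G.components V A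
    · obtain ⟨x, -, hx⟩ := mem_image.1 hC
      exact ⟨x, fun _ ↦ hx⟩
    · exact ⟨x₀, fun h ↦ absurd h hC⟩
  choose rep hrep using hrep
  set w : Set α → (α →₀ ZMod 2) := fun C ↦ Finsupp.single (rep C) 1 + Finsupp.single x₀ 1
  set T := (G.components V A).erase (comp x₀)
  set U := span (ZMod 2) (G.edgeVec '' (A : Set β))
  set W := span (ZMod 2) (w '' (T : Set (Set α)))
  have hcancel (a b c : α →₀ ZMod 2) : (a + b) + (b + c) = a + c := by
    rw [add_assoc, ← add_assoc b, finsupp_zmod_two_add_self, zero_add]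
  have hx : ∀ x ∈ V, (Finsupp.single x 1 + Finsupp.single x₀ 1 : α →₀ ZMod 2) ∈ U ⊔ W := by
    intro x hx
    by_cases h : comp x = comp x₀
    · exact mem_sup_left (single_add_single_mem_span_iff.2 (componentSet_eq_iff.1 h))
    · rw [← hcancel _ (Finsupp.single (rep (comp x)) 1)]
      refine add_mem (mem_sup_left ?_) (mem_sup_right (subset_span ⟨comp x, ?_, rfl⟩))
      · exact single_add_single_mem_span_iff.2 (componentSet_eq_iff.1 (hrep _ (hP x hx)).symm)
      · exact mem_erase.2 ⟨h, hP x hx⟩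
  have hle : span (ZMod 2) (G.edgeVec '' (E : Set β)) ≤ U ⊔ W := by
    rw [span_le]
    rintro _ ⟨e, -, rfl⟩
    by_cases hex : ∃ u w, G.IsLink e u w
    · obtain ⟨u, w, huw⟩ := hex
      have hu : u ∈ V := by rw [← mem_coe, hV]; exact huw.left_mem
      have hw : w ∈ V := by rw [← mem_coe, hV]; exact huw.right_mem
      rw [huw.edgeVec_eq, ← hcancel _ (Finsupp.single x₀ 1),
        add_comm (Finsupp.single x₀ 1) (Finsupp.single w 1)]
      exact add_mem (hx u hu) (hx w hw)
    · rw [edgeVec, dif_neg hex]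
      exact zero_mem _
  have : FiniteDimensional (ZMod 2) U :=
    FiniteDimensional.span_of_finite _ (A.finite_toSet.image _)
  have : FiniteDimensional (ZMod 2) W :=
    FiniteDimensional.span_of_finite _ (T.finite_toSet.image _)
  have h1 := Submodule.finrank_mono hle
  have h2 := Submodule.finrank_add_le_finrank_add_finrank U W
  have h3 : Module.finrank (ZMod 2) W ≤ #T := finrank_span_image_finset_le w T
  have h4 : #T + 1 = #(G.components V A) := card_erase_add_one (hP x₀ hx₀)
  omega

/-- The edges with exactly one end in `C`. -/
def edgeBoundary (G : Graph α β) (C : Set α) : Set β :=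
  {e | ∃ x ∈ C, ∃ y ∉ C, G.IsLink e x y}

theorem isEdgeCut_edgeBoundary {C : Set α} {x y : α} (hx : x ∈ G.vertexSet) (hxC : x ∈ C)
    (hy : y ∈ G.vertexSet) (hyC : y ∉ C) : G.IsEdgeCut (G.edgeBoundary C) := by
  refine ⟨fun e ⟨_, _, _, _, h⟩ ↦ h.edge_mem, fun hconn ↦ hyC ?_⟩
  suffices h : ∀ z, Relation.ReflTransGen (G.deleteEdges (G.edgeBoundary C)).Adj x z → z ∈ C from
    h y (hconn.2 x hx y hy)
  intro z hz
  induction hz with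
  | refl => exact hxC
  | @tail u w _ huw ih =>
    obtain ⟨e, he⟩ := huw
    rw [deleteEdges_isLink] at he
    by_contra hwC
    exact he.2 ⟨u, ih, w, hwC, he.1⟩

theorem IsEdgeConnected.le_encard {l : ℕ} (h : G.IsEdgeConnected l) {S : Set β}
    (hS : G.IsEdgeCut S) : (l : ℕ∞) ≤ S.encard :=
  h.trans (iInf₂_le S hS)

/-- Every component of `(V, A)` has at least `l` boundary edges, and an edge lies in the boundary of
at most two components. -/
theorem IsEdgeConnected.card_components_mul_le [DecidableEq β] {l : ℕ} (h : G.IsEdgeConnected l)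
    {V : Finset α} (hV : (V : Set α) = G.vertexSet) {E : Finset β} (hE : (E : Set β) = G.edgeSet)
    (A : Finset β) (hc : 2 ≤ #(G.components V A)) : #(G.components V A) * l ≤ #(E \ A) * 2 := by
  classical
  refine card_mul_le_card_mul (fun C e ↦ e ∈ G.edgeBoundary C) (fun C hC ↦ ?_) fun e he ↦ ?_
  · obtain ⟨x, hx, rfl⟩ := mem_image.1 hC
    obtain ⟨D, hD, hne⟩ := exists_mem_ne hc ((G.restrict (A : Set β)).componentSet x)
    obtain ⟨y, hy, rfl⟩ := mem_image.1 hD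
    have hcut := isEdgeCut_edgeBoundary (G := G) (C := (G.restrict (A : Set β)).componentSet x)
      (by rw [← hV]; exact hx) Relation.ReflTransGen.refl (by rw [← hV]; exact hy)
      fun hxy ↦ hne (componentSet_eq_iff.2 hxy).symm
    have hle := h.le_encard hcut
    have hsub : G.edgeBoundary ((G.restrict (A : Set β)).componentSet x) ⊆
        (bipartiteAbove (fun C e ↦ e ∈ G.edgeBoundary C) (E \ A)
          ((G.restrict (A : Set β)).componentSet x) : Finset β) := by
      intro e he
      refine mem_filter.2 ⟨mem_sdiff.2 ⟨?_, fun heA ↦ ?_⟩, he⟩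
      · rw [← mem_coe, hE]
        exact hcut.1 he
      · obtain ⟨u, hu, w, hw, huw⟩ := he
        exact hw (Relation.ReflTransGen.tail hu ⟨e, heA, huw⟩)
    have := hle.trans (Set.encard_le_encard hsub)
    rwa [Set.encard_coe_eq_coe_finsetCard, Nat.cast_le] at this
  · have heG : e ∈ G.edgeSet := by rw [← hE]; exact (mem_sdiff.1 he).1
    obtain ⟨u, w, huw⟩ := G.exists_isLink_of_mem_edgeSet heG
    refine (card_le_card (t := {(G.restrict (A : Set β)).componentSet u,
      (G.restrict (A : Set β)).componentSet w}) fun C hC ↦ ?_).trans card_le_two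
    obtain ⟨hC, a, ha, b, -, hab⟩ := mem_filter.1 hC
    obtain ⟨x, -, rfl⟩ := mem_image.1 hC
    rw [componentSet_eq_iff.2 ha, mem_insert, mem_singleton]
    obtain ⟨rfl, -⟩ | ⟨rfl, -⟩ := hab.eq_and_eq_or_eq_and_eq huw
    · exact Or.inl rfl
    · exact Or.inr rfl

/-! ### Spanning tree packings after deleting edges -/

/-- The rank condition of `exists_disjoint_bases` holds for `G - F`: if `(V, A)` has `c ≥ 2`
components, then at least `c * (k + m) / 2 - m` edges of `G - F` lie outside `A`, and this is at
least `k * (c - 1)` because `(c - 2) * (m - k) ≥ 0`. -/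
theorem IsEdgeConnected.hasSpanningTreePacking {k m : ℕ} (hk : 1 ≤ k) (hkm : k ≤ m)
    (hV : G.vertexSet.Finite) (hE : G.edgeSet.Finite) (h : G.IsEdgeConnected (k + m))
    {F : Set β} (hFE : F ⊆ G.edgeSet) (hF : F.encard ≤ m) :
    (G.deleteEdges F).HasSpanningTreePacking k := by
  classical
  have hconn (S : Set β) (hSE : S ⊆ G.edgeSet) (hS : S.encard ≤ m) :
      (G.deleteEdges S).Connected := by
    by_contra hcut
    have := (h.le_encard ⟨hSE, hcut⟩).trans hS
    rw [Nat.cast_le] at this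
    omega
  lift F to Finset β using hE.subset hFE
  obtain ⟨V, hV⟩ := hV.exists_finset_coe
  obtain ⟨E, hE⟩ := hE.exists_finset_coe
  rw [Set.encard_coe_eq_coe_finsetCard, Nat.cast_le] at hF
  set H := G.deleteEdges F
  have hH : H.Connected := hconn F hFE (by simpa [Set.encard_coe_eq_coe_finsetCard])
  have hHV : (V : Set α) = H.vertexSet := hV
  have hHE : ((E \ F : Finset β) : Set β) = H.edgeSet := by
    rw [coe_sdiff, hE]
    rfl
  have hne : V.Nonempty := by
    rw [← coe_nonempty, hHV]
    exact hH.1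
  obtain ⟨I, hI, hspan⟩ := exists_disjoint_bases (K := ZMod 2) (ι := Fin k) H.edgeVec (E \ F) <| by
    intro A hA
    have hrank := finrank_span_edgeVec_le hHV hne (E \ F) A
    have hcomp : H.components V A = G.components V A := by
      have : H.restrict (A : Set β) = G.restrict A := by
        refine Graph.ext rfl fun e x y ↦ ?_
        simp only [restrict_isLink, H, deleteEdges_isLink]
        exact ⟨fun h ↦ ⟨h.1, h.2.1⟩, fun h ↦ ⟨h.1, h.2, (mem_sdiff.1 (hA h.1)).2⟩⟩
      rw [components, components, this]
    rw [hcomp] at hrank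
    have hcard : #(E \ A) ≤ #((E \ F) \ A) + #F := by
      refine (card_le_card fun e he ↦ ?_).trans (card_union_le _ _)
      simp only [mem_union, mem_sdiff] at he ⊢
      tauto
    rw [Fintype.card_fin]
    rcases le_or_gt 2 #(G.components V A) with hc | hc
    -- with `c + 2` components and `m = k + d`, the slack in the estimate is `c * d`
    · have hcount := h.card_components_mul_le hV hE A hc
      obtain ⟨d, rfl⟩ := Nat.exists_eq_add_of_le hkm
      obtain ⟨c, hc'⟩ := Nat.exists_eq_add_of_le' hc
      rw [hc'] at hcount hrank
      have := Nat.mul_le_mul_left k hrank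
      have : 0 ≤ c * d := Nat.zero_le _
      nlinarith
    · have := Nat.mul_le_mul_left k (show Module.finrank (ZMod 2) (span (ZMod 2)
        (H.edgeVec '' ((E \ F : Finset β) : Set β))) ≤ Module.finrank (ZMod 2)
        (span (ZMod 2) (H.edgeVec '' (A : Set β))) by omega)
      omega
  rw [hHE] at hspan
  refine ⟨fun i ↦ H.restrict (I i), fun i ↦ ⟨⟨restrict_le, rfl⟩,
    connected_restrict_of_span_le hH (hspan i), acyclic_restrict_of_linearIndepOn (hI.indep i)⟩,
    fun i j hij ↦ ?_⟩
  exact Disjoint.mono Set.inter_subset_right Set.inter_subset_right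
    (disjoint_coe.2 (hI.disjoint i j hij))

/-- A spanning tree of `G - F` which avoids `S` would be a connected spanning subgraph of
`G - S`. -/
theorem IsEdgeCut.inter_edgeSet_nonempty {S F : Set β} (hS : G.IsEdgeCut S) {T : Graph α β}
    (hT : T.IsSpanningTree (G.deleteEdges F)) : (S \ F ∩ T.edgeSet).Nonempty := by
  by_contra hempty
  refine hS.2 ⟨?_, fun x hx y hy ↦ ?_⟩
  · simpa [hT.1.vertexSet_eq] using hT.2.1.1
  · have hVT : T.vertexSet = G.vertexSet := hT.1.vertexSet_eq
    have hwalk := hT.2.1.2 x (hVT ▸ hx) y (hVT ▸ hy)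
    refine Relation.ReflTransGen.mono ?_ _ _ hwalk
    rintro u w ⟨e, he⟩
    have heF := he.mono hT.1.le
    rw [deleteEdges_isLink] at heF
    refine ⟨e, ?_⟩
    rw [deleteEdges_isLink]
    exact ⟨heF.1, fun heS ↦ hempty ⟨e, ⟨heS, heF.2⟩, he.edge_mem⟩⟩

/-- `k` disjoint spanning trees of `G - F` need `k` distinct edges of `S \ F`. -/
theorem IsEdgeCut.le_encard_diff {S F : Set β} (hS : G.IsEdgeCut S) {k : ℕ}
    (hF : (G.deleteEdges F).HasSpanningTreePacking k) : (k : ℕ∞) ≤ (S \ F).encard := by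
  obtain ⟨T, hT, hd⟩ := hF
  choose e he using fun i ↦ hS.inter_edgeSet_nonempty (hT i)
  have hinj : Function.Injective e := by
    intro i j hij
    by_contra hne
    exact Set.disjoint_left.1 (hd i j hne) (he i).2 (hij ▸ (he j).2)
  have h1 : (Set.range e).encard ≤ (S \ F).encard :=
    Set.encard_le_encard (Set.range_subset_iff.2 fun i ↦ (he i).1)
  rwa [← Set.image_univ, hinj.encard_image, Set.encard_univ, ENat.card_eq_coe_fintype_card,
    Fintype.card_fin] at h1

theorem isEdgeConnected_of_hasSpanningTreePacking {k m : ℕ} (hk : 1 ≤ k)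
    (h : ∀ F : Set β, F ⊆ G.edgeSet → F.encard ≤ (m : ℕ∞) →
      (G.deleteEdges F).HasSpanningTreePacking k) : G.IsEdgeConnected (k + m) := by
  refine le_iInf₂ fun S hS ↦ ?_
  rcases le_total S.encard m with hSm | hSm
  · have := hS.le_encard_diff (h S hS.1 hSm)
    rw [Set.sdiff_self, Set.encard_empty, nonpos_iff_eq_zero, Nat.cast_eq_zero] at this
    omega
  · obtain ⟨F, hFS, hF⟩ := Set.exists_subset_encard_eq hSm
    rw [← Set.encard_sdiff_add_encard_of_subset hFS, hF, Nat.cast_add]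
    gcongr
    exact hS.le_encard_diff (h F (hFS.trans hS.1) hF.le)

/-- The common generalization of the two parts of the result, with `k + m` in place of `2 * k` and
`2 * k + 1`. -/
theorem isEdgeConnected_add_iff {k m : ℕ} (hk : 1 ≤ k) (hkm : k ≤ m)
    (hV : G.vertexSet.Finite) (hE : G.edgeSet.Finite) :
    G.IsEdgeConnected (k + m) ↔ ∀ F : Set β, F ⊆ G.edgeSet → F.encard ≤ (m : ℕ∞) →
      (G.deleteEdges F).HasSpanningTreePacking k :=
  ⟨fun h _ hFE hF ↦ h.hasSpanningTreePacking hk hkm hV hE hFE hF,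
    isEdgeConnected_of_hasSpanningTreePacking hk⟩

end Graph

theorem mainTheorem5 {α β : Type*} (G : Graph α β) (hloop : G.Loopless)
    (hV : G.vertexSet.Finite) (hE : G.edgeSet.Finite) :
    (∀ k : ℕ, G.IsEdgeConnected (2 * k) ↔
      ∀ F : Set β, F ⊆ G.edgeSet → F.encard ≤ (k : ℕ∞) →
        (G.deleteEdges F).HasSpanningTreePacking k) ∧
    (∀ k : ℕ, 1 ≤ k → (G.IsEdgeConnected (2 * k + 1) ↔
      ∀ F : Set β, F ⊆ G.edgeSet → F.encard ≤ (k : ℕ∞) + 1 →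
        (G.deleteEdges F).HasSpanningTreePacking k)) := by
  refine ⟨fun k ↦ ?_, fun k hk ↦ ?_⟩
  · rcases Nat.eq_zero_or_pos k with rfl | hk
    -- both sides hold: there is nothing to cut and nothing to pack
    · exact ⟨fun _ _ _ _ ↦ ⟨Fin.elim0, fun i ↦ i.elim0, fun i ↦ i.elim0⟩,
        fun _ ↦ by simp [Graph.IsEdgeConnected]⟩
    · rw [two_mul]
      exact Graph.isEdgeConnected_add_iff hk le_rfl hV hE
  · rw [two_mul, add_assoc]
    simpa using Graph.isEdgeConnected_add_iff (m := k + 1) hk (Nat.le_succ k) hV hE
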